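/- An association scheme $(X,S)$ is a finite non-empty set $X$ with a partition $S$ of $X\times X$ into non-empty relations such that $1_X=\{(x,x)\mid x\in X\}\in S$; $s^*=\{(y,x)\mid (x,y)\in s\}\in S$ for all $s\in S$; and for all $s,t,u\in S$ the number $|\{z\mid (x,z)\in s,\ (z,y)\in t\}|$ is the same for all $(x,y)\in u$. An isomorphism from $(X,S)$ to $(Y,T)$ is a pair of bijections $X\to Y$, $S\to T$, both written $\phi$, such that $(x,y)\in s$ implies $(\phi(x),\phi(y))\in\phi(s)$. Let $\mathrm{Iso}(X,S)$ be the set of isomorphisms from $(X,S)$ to itself, and $\mathrm{Aut}(X,S)$ the set of those with $\phi(s)=s$ for all $s\in S$. For a Hadamard matrix $H$ (entries $\pm1$, $HH^T=nI$) with rows and columns indexed by $X$, let $\widetilde X=\{x_{ab}\mid x\in X,\ a,b\in\mathbb F_2\}=X\times\mathbb F_2\times\mathbb F_2$, $H^{T(0)}=H$, $H^{T(1)}=H^T$, and $$\widetilde t=\{(x_{ab},x_{a(b+1)})\},\qquad \widetilde s=\{(x_{ab},y_{ac})\mid (x,y)\in s\}\quad (s\in S\setminus\{1_X\}),$$ $$r^1_H=\{(x_{ab},y_{cd})\mid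 a\ne c,\ (H^{T(a)})_{xy}=(-1)^{b+d}\},\qquad r^{-1}_H=\{(x_{ab},y_{cd})\mid a\neq c\}\setminus r^1_H,$$ $$S(H)=\{1_{\widetilde X},\widetilde t\}\cup\{\widetilde s\mid s\in S\setminus\{1_X\}\}\cup\{r^1_H,r^{-1}_H\}.$$ Two Hadamard matrices are equivalent if one is transformed into the other by a series of row or column permutations and negations of rows or columns. For $x_0\in X$ let $$\mathrm{Aut}_{x_0}(H)=\{(\sigma,\tau)\in \mathrm{Sym}(X)\times \mathrm{Sym}(X)\mid P_\sigma^{-1}HP_\tau=H,\ \sigma(x_0)=x_0,\ \tau(x_0)=x_0\},$$ where $P_\sigma$ denotes the permutation matrix of $\sigma$. Theorem. Let $(X,S)$ be an association scheme of order $n=|X|$, let $x_0\in X$, and let $H_0$ be a Hadamard matrix with rows and columns indexed by $X$, normalized so that all entries in the row $x_0$ and in the column $x_0$ are $1$ (every equivalence class of Hadamard matrices contains such a matrix). Then $(\widetilde X,S(H))$ is an association scheme for every $H$ equivalent to $H_0$, and the set $\{(\widetilde X,S(H))\mid H\text{ is equivalent to }H_0\}$ contains at least $$\frac{(n-1)!\,(n-1)!}{2\,|\mathrm{Aut}_{x_0}(H_0)|\,|\mathrm{Aut}(X,S)|\,|\mathrm{Iso}(X,S)|}$$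 isomorphism classes of association schemes. -/

import Mathlib

/-- `(X, S)` is an association scheme: `S` is a partition of `X × X` that contains the diagonal, is
closed under reversal of relations, and has well-defined intersection numbers. -/
structure IsAssociationScheme {X : Type*} (S : Set (Set (X × X))) : Prop where
  partition : Setoid.IsPartition S
  diag_mem : {p : X × X | p.1 = p.2} ∈ S
  reverse_mem : ∀ s ∈ S, {p : X × X | (p.2, p.1) ∈ s} ∈ S
  intersection : ∀ s ∈ S, ∀ t ∈ S, ∀ u ∈ S, ∃ c : ℕ, ∀ α β : X, (α, β) ∈ u →
    Nat.card {γ : X // (α, γ) ∈ s ∧ (γ, β) ∈ t} = c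

/-- An isomorphism from `(X, S)` to `(Y, T)`: a bijection `X → Y` together with a bijection `S → T`
such that `(x, y) ∈ s` implies `(φ x, φ y) ∈ φ s`. -/
@[ext]
structure SchemeIso {X Y : Type*} (S : Set (Set (X × X))) (T : Set (Set (Y × Y))) where
  onPoints : X ≃ Y
  onRels : S ≃ T
  map_mem : ∀ (s : S) (x y : X), (x, y) ∈ s.1 → (onPoints x, onPoints y) ∈ (onRels s).1

/-- `Aut(X, S)`: the isomorphisms from `(X, S)` to itself that fix every relation. -/
def SchemeAut {X : Type*} (S : Set (Set (X × X))) : Type _ :=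
  {f : SchemeIso S S // ∀ s : S, f.onRels s = s}

namespace SchemeIso

/-- The identity isomorphism. -/
def refl {X : Type*} (S : Set (Set (X × X))) : SchemeIso S S :=
  ⟨Equiv.refl X, Equiv.refl S, fun _ _ _ h => h⟩

/-- Composition of isomorphisms. -/
def trans {X Y Z : Type*} {S : Set (Set (X × X))} {T : Set (Set (Y × Y))}
    {U : Set (Set (Z × Z))} (f : SchemeIso S T) (g : SchemeIso T U) : SchemeIso S U :=
  ⟨f.onPoints.trans g.onPoints, f.onRels.trans g.onRels,
    fun s x y h => g.map_mem _ _ _ (f.map_mem s x y h)⟩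

/-- The inverse of an isomorphism of association schemes. -/
def symm {X Y : Type*} {S : Set (Set (X × X))} {T : Set (Set (Y × Y))}
    (hS : IsAssociationScheme S) (hT : IsAssociationScheme T) (f : SchemeIso S T) :
    SchemeIso T S :=
  ⟨f.onPoints.symm, f.onRels.symm, fun t x y h => by
    obtain ⟨s, ⟨hs, hxy⟩, -⟩ := hS.partition.2 (f.onPoints.symm x, f.onPoints.symm y)
    have h1 := f.map_mem ⟨s, hs⟩ _ _ hxy
    simp only [Equiv.apply_symm_apply] at h1
    have h2 : (f.onRels ⟨s, hs⟩).1 = t.1 :=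
      (hT.partition.2 (x, y)).unique ⟨(f.onRels ⟨s, hs⟩).2, h1⟩ ⟨t.2, h⟩
    have h3 : f.onRels.symm t = ⟨s, hs⟩ := by
      rw [Equiv.symm_apply_eq]
      exact (Subtype.ext h2).symm
    rw [h3]
    exact hxy⟩

end SchemeIso

/-- `H` is normalized with respect to `x₀`: the row and the column indexed by `x₀` consist of
ones. -/
def IsNormalizedAt {X : Type*} (H : Matrix X X ℤ) (x₀ : X) : Prop :=
  ∀ x, H x₀ x = 1 ∧ H x x₀ = 1

/-- One elementary transformation: a permutation of the rows, a permutation of the columns, or the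
negation of one row or of one column. -/
inductive HadamardStep {X : Type*} [DecidableEq X] : Matrix X X ℤ → Matrix X X ℤ → Prop
  | permRows (H : Matrix X X ℤ) (σ : Equiv.Perm X) : HadamardStep H (H.submatrix σ id)
  | permCols (H : Matrix X X ℤ) (τ : Equiv.Perm X) : HadamardStep H (H.submatrix id τ)
  | negRow (H : Matrix X X ℤ) (z : X) :
      HadamardStep H (Matrix.of fun x y => if x = z then -H x y else H x y)
  | negCol (H : Matrix X X ℤ) (z : X) :
      HadamardStep H (Matrix.of fun x y => if y = z then -H x y else H x y)

/-- Equivalence of Hadamard matrices: a finite series of elementary transformations. -/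
def HadamardEquivalent {X : Type*} [DecidableEq X] (H H' : Matrix X X ℤ) : Prop :=
  Relation.ReflTransGen HadamardStep H H'

/-- `Aut_{x₀}(H)`: the pairs `(σ, τ)` of permutations that fix `x₀` and satisfy
`P_σ⁻¹ H P_τ = H`. -/
def HadamardAut {X : Type*} (H : Matrix X X ℤ) (x₀ : X) : Set (Equiv.Perm X × Equiv.Perm X) :=
  {p | H.submatrix p.1 p.2 = H ∧ p.1 x₀ = x₀ ∧ p.2 x₀ = x₀}

/-- The point set `X̃`; the triple `(x, a, b)` is the point `x_{ab}`. -/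
abbrev TildePt (X : Type*) : Type _ := X × ZMod 2 × ZMod 2

/-- `t̃ = {(x_{ab}, x_{a(b+1)})}`. -/
def relT (X : Type*) : Set (TildePt X × TildePt X) :=
  {p | ∃ (x : X) (a b : ZMod 2), p = ((x, a, b), (x, a, b + 1))}

/-- `s̃ = {(x_{ab}, y_{ac}) | (x, y) ∈ s}`. -/
def relTilde {X : Type*} (s : Set (X × X)) : Set (TildePt X × TildePt X) :=
  {p | ∃ (x y : X) (a b c : ZMod 2), (x, y) ∈ s ∧ p = ((x, a, b), (y, a, c))}

/-- `H^{T(a)}`: `H` if `a = 0` and the transpose of `H` if `a = 1`. -/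
def transposeIf {X : Type*} (H : Matrix X X ℤ) (a : ZMod 2) : Matrix X X ℤ :=
  if a = 0 then H else H.transpose

/-- `r¹_H = {(x_{ab}, y_{cd}) | (1 - δ_{ac}) (H^{T(a)})_{xy} = (-1)^{b+d}}`. -/
def relPos {X : Type*} (H : Matrix X X ℤ) : Set (TildePt X × TildePt X) :=
  {p | ∃ (x y : X) (a b c d : ZMod 2), p = ((x, a, b), (y, c, d)) ∧
    (1 - (if a = c then 1 else 0)) * transposeIf H a x y = (-1) ^ (b + d).val}

/-- `r⁻¹_H = {(x_{ab}, y_{cd}) | a ≠ c} \ r¹_H`. -/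
def relNeg {X : Type*} (H : Matrix X X ℤ) : Set (TildePt X × TildePt X) :=
  {p | ∃ (x y : X) (a b c d : ZMod 2), p = ((x, a, b), (y, c, d)) ∧ a ≠ c} \ relPos H

/-- `S(H) = {1, t̃} ∪ {s̃ | s ∈ S \ {1_X}} ∪ {r¹_H, r⁻¹_H}`. -/
def hadamardScheme {X : Type*} (S : Set (Set (X × X))) (H : Matrix X X ℤ) :
    Set (Set (TildePt X × TildePt X)) :=
  {{p | p.1 = p.2}, relT X} ∪ relTilde '' (S \ {{p : X × X | p.1 = p.2}}) ∪ {relPos H, relNeg H}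

/-- The association schemes in `{(X̃, S(H)) | H is equivalent to H₀}`. -/
def SchemeFamily {X : Type*} [DecidableEq X] (S : Set (Set (X × X))) (H₀ : Matrix X X ℤ) :
    Type _ :=
  {R : Set (Set (TildePt X × TildePt X)) //
    IsAssociationScheme R ∧ ∃ H, HadamardEquivalent H₀ H ∧ R = hadamardScheme S H}

/-- Isomorphism as an equivalence relation on this set of schemes. -/
def schemeFamilySetoid {X : Type*} [DecidableEq X] (S : Set (Set (X × X)))
    (H₀ : Matrix X X ℤ) : Setoid (SchemeFamily S H₀) where
  r R R' := Nonempty (SchemeIso R.1 R'.1)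
  iseqv :=
    { refl := fun R => ⟨SchemeIso.refl R.1⟩
      symm := fun {R R'} ⟨f⟩ => ⟨SchemeIso.symm R.2.1 R'.2.1 f⟩
      trans := fun ⟨f⟩ ⟨g⟩ => ⟨f.trans g⟩ }

/-- The number of isomorphism classes of association schemes in
`{(X̃, S(H)) | H is equivalent to H₀}`. -/
noncomputable def numIsoClasses {X : Type*} [DecidableEq X] (S : Set (Set (X × X)))
    (H₀ : Matrix X X ℤ) : ℕ :=
  Nat.card (Quotient (schemeFamilySetoid S H₀))

/-!
Every matrix equivalent to `H₀` is Hadamard, and for a Hadamard matrix `H` the intersection numbers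
of `S(H)` can be computed directly. The relations `1` and `t̃` are graphs of permutations, composition
of two `s̃` or of one `s̃` with `r^{±1}_H` reduces to intersection numbers and valencies of `(X, S)`, and
composition of two relations `r^{±1}_H` is governed by the fact that two distinct rows (or columns)
of `H` agree in exactly half of the places (`card_signBit_add_eq_of_ne`). All conditions on signs
are written additively in `ZMod 2`, through the exponents `signBit`.

For the lower bound, let `σ`, `τ` run through the permutations of `X` that fix `x₀`. The matrices
`P_σ⁻¹ H₀ P_τ` are normalized and equivalent to `H₀`, and each of them arises from at most
`|Aut_{x₀}(H₀)|` of the `(n-1)!²` pairs (`card_permuted_fiber_le`). An isomorphism between `S(H)` and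
`S(H')` fixes `t̃`, the only relation of valency one besides the diagonal if `n > 1`, and permutes
the relations `s̃`, which are those unchanged by composition with `t̃`. So it preserves or exchanges
the two halves `a = 0` and `a = 1`, and induces on each half a permutation of `X`; both
permutations belong to `Iso(X, S)` and act in the same way on `S`, so they differ by an element of
`Aut(X, S)`. Through these permutations `H'` or its transpose arises from `H` by negating rows and
columns (`SchemeIso.exists_signBit_eq`), and a normalized matrix is determined by its
class under such negations (`eq_of_signBit_eq`). Hence an isomorphism class contains `S(H')` for at
most `2 |Iso(X, S)| |Aut(X, S)|` of the matrices `H'`.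
-/

/-! ### The relations between the two halves -/

theorem neg_one_pow_val_inj (a b : ZMod 2) : (-1 : ℤ) ^ a.val = (-1) ^ b.val ↔ a = b := by
  revert a b; decide

theorem neg_one_pow_val_add (a b : ZMod 2) :
    (-1 : ℤ) ^ (a + b).val = (-1) ^ a.val * (-1) ^ b.val := by
  revert a b; decide

theorem ZMod.two_eq_of_ne_of_ne {a b c : ZMod 2} (h : a ≠ b) (h' : c ≠ b) : a = c := by
  revert a b c; decide

/-- The exponent `e` with `(H^{T(a)})_{xy} = (-1)^e`, for a matrix `H` with entries `±1`. -/
def signBit {X : Type*} (H : Matrix X X ℤ) (a : ZMod 2) (x y : X) : ZMod 2 :=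
  if transposeIf H a x y = 1 then 0 else 1

/-- The pairs `(x_{ab}, y_{cd})` with `a ≠ c` and `(-1)^{b+d} = (-1)^e (H^{T(a)})_{xy}`, the
condition being written additively in `ZMod 2`. For `e = 0` and `e = 1` these are `r¹_H` and
`r⁻¹_H`. -/
def crossRel {X : Type*} (H : Matrix X X ℤ) (e : ZMod 2) : Set (TildePt X × TildePt X) :=
  {p | p.1.2.1 ≠ p.2.2.1 ∧ p.2.2.2 = p.1.2.2 + signBit H p.1.2.1 p.1.1 p.2.1 + e}

section
variable {X : Type*} {S : Set (Set (X × X))} {H : Matrix X X ℤ}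

theorem Matrix.IsHadamard.eq_one_or_neg_one [Fintype X] [DecidableEq X] (hH : H.IsHadamard)
    (x y : X) : H x y = 1 ∨ H x y = -1 := by
  have := (hH.apply_mem x y).1
  rw [star_trivial] at this
  exact mul_self_eq_one_iff.1 this

theorem transposeIf_isHadamard [Fintype X] [DecidableEq X] (hH : H.IsHadamard) (a : ZMod 2) :
    (transposeIf H a).IsHadamard := by
  unfold transposeIf
  split_ifs
  exacts [hH, hH.transpose]

theorem transposeIf_eq_neg_one_pow (hH : ∀ x y, H x y = 1 ∨ H x y = -1) (a : ZMod 2) (x y : X) :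
    transposeIf H a x y = (-1) ^ (signBit H a x y).val := by
  unfold signBit transposeIf
  split_ifs with h1 h2 h2
  · simpa using h2
  · exact (hH x y).resolve_left h2
  · simpa using h2
  · exact (hH y x).resolve_left h2

theorem signBit_symm {a c : ZMod 2} (h : a ≠ c) (x y : X) :
    signBit H a x y = signBit H c y x := by
  have : (a = 0 ∧ c = 1) ∨ (a = 1 ∧ c = 0) := by revert a c; decide
  rcases this with ⟨rfl, rfl⟩ | ⟨rfl, rfl⟩ <;> simp [signBit, transposeIf]

@[simp] theorem mem_relT {x y : X} {a b c d : ZMod 2} :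
    ((x, a, b), (y, c, d)) ∈ relT X ↔ x = y ∧ a = c ∧ d = b + 1 := by
  simp only [relT, Set.mem_ofPred_eq, Prod.mk.injEq]
  grind

@[simp] theorem mem_relTilde {s : Set (X × X)} {x y : X} {a b c d : ZMod 2} :
    ((x, a, b), (y, c, d)) ∈ relTilde s ↔ a = c ∧ (x, y) ∈ s := by
  simp only [relTilde, Set.mem_ofPred_eq, Prod.mk.injEq]
  grind

@[simp] theorem mem_crossRel {e : ZMod 2} {x y : X} {a b c d : ZMod 2} :
    ((x, a, b), (y, c, d)) ∈ crossRel H e ↔ a ≠ c ∧ d = b + signBit H a x y + e :=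
  Iff.rfl

theorem relPos_eq_crossRel (hH : ∀ x y, H x y = 1 ∨ H x y = -1) : relPos H = crossRel H 0 := by
  ext ⟨⟨x, a, b⟩, ⟨y, c, d⟩⟩
  have key : ((x, a, b), (y, c, d)) ∈ relPos H ↔
      (1 - (if a = c then 1 else 0)) * transposeIf H a x y = (-1) ^ (b + d).val := by
    simp only [relPos, Set.mem_ofPred_eq, Prod.mk.injEq]
    grind
  rw [key, mem_crossRel, transposeIf_eq_neg_one_pow hH]
  split_ifs with h
  · have : (-1 : ℤ) ^ (b + d).val ≠ 0 := pow_ne_zero _ (by norm_num)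
    simpa [h] using this.symm
  · simp only [sub_zero, one_mul, ne_eq, h, not_false_eq_true, true_and, neg_one_pow_val_inj]
    generalize signBit H a x y = v
    clear key
    revert v b d
    decide

theorem relNeg_eq_crossRel (hH : ∀ x y, H x y = 1 ∨ H x y = -1) : relNeg H = crossRel H 1 := by
  unfold relNeg
  rw [relPos_eq_crossRel hH]
  ext ⟨⟨x, a, b⟩, ⟨y, c, d⟩⟩
  have key : (∃ (x' y' : X) (a' b' c' d' : ZMod 2),
      (((x, a, b), (y, c, d)) : TildePt X × TildePt X) = ((x', a', b'), (y', c', d')) ∧ a' ≠ c') ↔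
      a ≠ c := by
    constructor
    · rintro ⟨_, _, _, _, _, _, h, hne⟩
      simp only [Prod.mk.injEq] at h
      grind
    · exact fun h => ⟨_, _, _, _, _, _, rfl, h⟩
  rw [Set.mem_sdiff, Set.mem_ofPred_eq, key, mem_crossRel, mem_crossRel, not_and]
  generalize signBit H a x y = v
  clear key
  revert a b c d v
  decide

theorem mem_hadamardScheme (hH : ∀ x y, H x y = 1 ∨ H x y = -1)
    {R : Set (TildePt X × TildePt X)} :
    R ∈ hadamardScheme S H ↔ R = {p | p.1 = p.2} ∨ R = relT X ∨
      (∃ s ∈ S, s ≠ {p | p.1 = p.2} ∧ R = relTilde s) ∨ ∃ e, R = crossRel H e := by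
  have : (∃ e, R = crossRel H e) ↔ R = relPos H ∨ R = relNeg H := by
    rw [relPos_eq_crossRel hH, relNeg_eq_crossRel hH]
    constructor
    · rintro ⟨e, rfl⟩
      rcases (by revert e; decide : e = 0 ∨ e = 1) with rfl | rfl <;> simp
    · rintro (h | h)
      exacts [⟨_, h⟩, ⟨_, h⟩]
  rw [this]
  simp only [hadamardScheme, Set.mem_union, Set.mem_insert_iff, Set.mem_singleton_iff,
    Set.mem_image, Set.mem_sdiff]
  grind

/-! ### The partition and its symmetry -/

theorem IsAssociationScheme.eq_of_mem (hS : IsAssociationScheme S) {s t : Set (X × X)}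
    (hs : s ∈ S) (ht : t ∈ S) {p : X × X} (hps : p ∈ s) (hpt : p ∈ t) : s = t :=
  (hS.partition.2 p).unique ⟨hs, hps⟩ ⟨ht, hpt⟩

theorem IsAssociationScheme.ne_of_mem (hS : IsAssociationScheme S) {s : Set (X × X)}
    (hs : s ∈ S) (hne : s ≠ {p | p.1 = p.2}) {x y : X} (hxy : (x, y) ∈ s) : x ≠ y :=
  fun h => hne (hS.eq_of_mem hs hS.diag_mem hxy h)

theorem IsAssociationScheme.exists_mem (hS : IsAssociationScheme S) (p : X × X) :
    ∃ s ∈ S, p ∈ s := by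
  obtain ⟨s, h, -⟩ := hS.partition.2 p
  exact ⟨s, h⟩

theorem hadamardScheme_isPartition (hS : IsAssociationScheme S) [Nonempty X]
    (hH : ∀ x y, H x y = 1 ∨ H x y = -1) : Setoid.IsPartition (hadamardScheme S H) := by
  refine ⟨?_, ?_⟩
  · obtain ⟨x⟩ := ‹Nonempty X›
    rw [mem_hadamardScheme hH]
    rintro (h | h | ⟨s, hs, -, h⟩ | ⟨e, h⟩)
    · exact (h.symm ▸ rfl : ((x, 0, 0), (x, 0, 0)) ∈ (∅ : Set (TildePt X × TildePt X)))
    · exact (h.symm ▸ (by simp) : ((x, 0, 0), (x, 0, 1)) ∈ (∅ : Set (TildePt X × TildePt X)))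
    · obtain ⟨⟨y, z⟩, hyz⟩ := Setoid.nonempty_of_mem_partition hS.partition hs
      exact (h.symm ▸ (by simpa using hyz) :
        ((y, 0, 0), (z, 0, 0)) ∈ (∅ : Set (TildePt X × TildePt X)))
    · exact (h.symm ▸ (by simp) :
        ((x, 0, 0), (x, 1, signBit H 0 x x + e)) ∈ (∅ : Set (TildePt X × TildePt X)))
  · rintro ⟨⟨x, a, b⟩, ⟨y, c, d⟩⟩
    have key : ∃ R ∈ hadamardScheme S H, ((x, a, b), (y, c, d)) ∈ R := by
      simp only [mem_hadamardScheme hH]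
      by_cases hac : a = c
      · by_cases hxy : x = y
        · by_cases hbd : b = d
          · exact ⟨_, Or.inl rfl, by simp [hac, hxy, hbd]⟩
          · refine ⟨_, Or.inr (Or.inl rfl), ?_⟩
            rw [mem_relT]
            exact ⟨hxy, hac, by revert b d; decide⟩
        · obtain ⟨s, hs, hmem⟩ := hS.exists_mem (x, y)
          refine ⟨_, Or.inr (Or.inr (Or.inl ⟨s, hs, ?_, rfl⟩)), mem_relTilde.2 ⟨hac, hmem⟩⟩
          rintro rfl
          exact hxy hmem
      · refine ⟨_, Or.inr (Or.inr (Or.inr ⟨d - (b + signBit H a x y), rfl⟩)), ?_⟩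
        simp [hac]
    obtain ⟨R, hR, hmem⟩ := key
    refine ⟨R, ⟨hR, hmem⟩, ?_⟩
    rintro R' ⟨hR', hmem'⟩
    rw [mem_hadamardScheme hH] at hR hR'
    have hb : b ≠ b + 1 := by simp
    rcases hR with rfl | rfl | ⟨s, hs, hs', rfl⟩ | ⟨e, rfl⟩ <;>
    rcases hR' with rfl | rfl | ⟨t, ht, ht', rfl⟩ | ⟨f, rfl⟩ <;>
    simp only [Set.mem_ofPred_eq, mem_relT, mem_relTilde, mem_crossRel, Prod.mk.injEq] at hmem hmem'
    all_goals first
      | rfl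
      | (exfalso; grind)
      | (exfalso; exact hS.ne_of_mem hs hs' hmem.2 (by tauto))
      | (exfalso; exact hS.ne_of_mem ht ht' hmem'.2 (by tauto))
      | rw [hS.eq_of_mem hs ht hmem.2 hmem'.2]
      | (have := hmem.2.symm.trans hmem'.2; rw [add_left_cancel this])

theorem hadamardScheme_reverse_mem (hS : IsAssociationScheme S)
    (hH : ∀ x y, H x y = 1 ∨ H x y = -1) {R : Set (TildePt X × TildePt X)}
    (hR : R ∈ hadamardScheme S H) : {p | (p.2, p.1) ∈ R} ∈ hadamardScheme S H := by
  rw [mem_hadamardScheme hH] at hR ⊢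
  rcases hR with rfl | rfl | ⟨s, hs, hs', rfl⟩ | ⟨e, rfl⟩
  · refine Or.inl ?_
    ext p
    exact eq_comm
  · refine Or.inr (Or.inl ?_)
    ext ⟨⟨x, a, b⟩, ⟨y, c, d⟩⟩
    simp only [Set.mem_ofPred_eq, mem_relT]
    have : b = d + 1 ↔ d = b + 1 := by revert b d; decide
    rw [this, eq_comm, @eq_comm _ c a]
  · refine Or.inr (Or.inr (Or.inl ⟨_, hS.reverse_mem s hs, ?_, ?_⟩))
    · intro h
      apply hs'
      ext ⟨x, y⟩
      have := Set.ext_iff.1 h (y, x)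
      simpa [eq_comm] using this
    · ext ⟨⟨x, a, b⟩, ⟨y, c, d⟩⟩
      simp only [Set.mem_ofPred_eq, mem_relTilde, eq_comm]
  · refine Or.inr (Or.inr (Or.inr ⟨e, ?_⟩))
    ext ⟨⟨x, a, b⟩, ⟨y, c, d⟩⟩
    simp only [Set.mem_ofPred_eq, mem_crossRel]
    rw [ne_comm]
    refine and_congr_right fun h => ?_
    rw [signBit_symm h x y]
    generalize signBit H c y x = v
    revert b d v e
    decide

end

/-! ### Intersection numbers -/

section
variable {X : Type*} {S : Set (Set (X × X))} {H : Matrix X X ℤ}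

/-- Composition on the left with the graph of a function has constant intersection numbers as soon
as the preimages of the relations under that function are again relations. -/
theorem exists_card_eq_of_graph_left {Y : Type*} {R : Set (Set (Y × Y))}
    (hR : Setoid.IsPartition R) {s t u : Set (Y × Y)} (f : Y → Y)
    (hs : ∀ p q, (p, q) ∈ s ↔ q = f p) (ht : {p : Y × Y | (f p.1, p.2) ∈ t} ∈ R) (hu : u ∈ R) :
    ∃ c : ℕ, ∀ p q : Y, (p, q) ∈ u → Nat.card {r : Y // (p, r) ∈ s ∧ (r, q) ∈ t} = c := by
  classical
  refine ⟨if {p : Y × Y | (f p.1, p.2) ∈ t} = u then 1 else 0, fun p q hpq => ?_⟩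
  have hiff : (f p, q) ∈ t ↔ {p : Y × Y | (f p.1, p.2) ∈ t} = u := by
    constructor
    · intro h
      exact (hR.2 (p, q)).unique ⟨ht, h⟩ ⟨hu, hpq⟩
    · rintro rfl
      exact hpq
  simp only [hs]
  split_ifs with h
  · have : Unique {r : Y // r = f p ∧ (r, q) ∈ t} :=
      ⟨⟨⟨f p, rfl, hiff.2 h⟩⟩, fun r => Subtype.ext r.2.1⟩
    exact Nat.card_unique
  · have : IsEmpty {r : Y // r = f p ∧ (r, q) ∈ t} :=
      ⟨fun r => h (hiff.1 (r.2.1 ▸ r.2.2))⟩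
    exact Nat.card_of_isEmpty

theorem exists_card_eq_of_graph_right {Y : Type*} {R : Set (Set (Y × Y))}
    (hR : Setoid.IsPartition R) {s t u : Set (Y × Y)} (f : Y → Y)
    (ht : ∀ p q, (p, q) ∈ t ↔ p = f q) (hs : {p : Y × Y | (p.1, f p.2) ∈ s} ∈ R) (hu : u ∈ R) :
    ∃ c : ℕ, ∀ p q : Y, (p, q) ∈ u → Nat.card {r : Y // (p, r) ∈ s ∧ (r, q) ∈ t} = c := by
  classical
  refine ⟨if {p : Y × Y | (p.1, f p.2) ∈ s} = u then 1 else 0, fun p q hpq => ?_⟩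
  have hiff : (p, f q) ∈ s ↔ {p : Y × Y | (p.1, f p.2) ∈ s} = u := by
    constructor
    · intro h
      exact (hR.2 (p, q)).unique ⟨hs, h⟩ ⟨hu, hpq⟩
    · rintro rfl
      exact hpq
  simp only [ht]
  split_ifs with h
  · have : Unique {r : Y // (p, r) ∈ s ∧ r = f q} :=
      ⟨⟨⟨f q, hiff.2 h, rfl⟩⟩, fun r => Subtype.ext r.2.2⟩
    exact Nat.card_unique
  · have : IsEmpty {r : Y // (p, r) ∈ s ∧ r = f q} :=
      ⟨fun r => h (hiff.1 (r.2.2 ▸ r.2.1))⟩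
    exact Nat.card_of_isEmpty

/-- The permutation `x_{ab} ↦ x_{a(b+1)}`, whose graph is `t̃`. -/
def flipPt (p : TildePt X) : TildePt X := (p.1, p.2.1, p.2.2 + 1)

@[simp] theorem flipPt_mk (x : X) (a b : ZMod 2) : flipPt (x, a, b) = (x, a, b + 1) := rfl

theorem mem_relT_iff_eq_flipPt (p q : TildePt X) : (p, q) ∈ relT X ↔ q = flipPt p := by
  obtain ⟨x, a, b⟩ := p
  obtain ⟨y, c, d⟩ := q
  simp only [mem_relT, flipPt_mk, Prod.mk.injEq, eq_comm]

@[simp] theorem flipPt_flipPt (p : TildePt X) : flipPt (flipPt p) = p := by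
  obtain ⟨x, a, b⟩ := p
  simp [add_assoc, CharTwo.add_self_eq_zero]

theorem flipPt_ne (p : TildePt X) : flipPt p ≠ p := by
  obtain ⟨x, a, b⟩ := p
  simp

theorem hadamardScheme_flip_left_mem (hH : ∀ x y, H x y = 1 ∨ H x y = -1)
    {R : Set (TildePt X × TildePt X)} (hR : R ∈ hadamardScheme S H) :
    {p : TildePt X × TildePt X | (flipPt p.1, p.2) ∈ R} ∈ hadamardScheme S H := by
  rw [mem_hadamardScheme hH] at hR ⊢
  rcases hR with rfl | rfl | ⟨s, hs, hs', rfl⟩ | ⟨e, rfl⟩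
  · refine Or.inr (Or.inl ?_)
    ext p
    rw [mem_relT_iff_eq_flipPt]
    exact eq_comm
  · refine Or.inl ?_
    ext p
    simp only [Set.mem_ofPred_eq, mem_relT_iff_eq_flipPt, flipPt_flipPt, eq_comm]
  · refine Or.inr (Or.inr (Or.inl ⟨s, hs, hs', ?_⟩))
    ext ⟨⟨x, a, b⟩, ⟨y, c, d⟩⟩
    simp
  · refine Or.inr (Or.inr (Or.inr ⟨e + 1, ?_⟩))
    ext ⟨⟨x, a, b⟩, ⟨y, c, d⟩⟩
    simp only [Set.mem_ofPred_eq, flipPt_mk, mem_crossRel]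
    rw [show b + 1 + signBit H a x y + e = b + signBit H a x y + (e + 1) by ring]

theorem hadamardScheme_flip_right_mem (hH : ∀ x y, H x y = 1 ∨ H x y = -1)
    {R : Set (TildePt X × TildePt X)} (hR : R ∈ hadamardScheme S H) :
    {p : TildePt X × TildePt X | (p.1, flipPt p.2) ∈ R} ∈ hadamardScheme S H := by
  convert hadamardScheme_flip_left_mem hH hR using 1
  rw [mem_hadamardScheme hH] at hR
  ext ⟨⟨x, a, b⟩, ⟨y, c, d⟩⟩
  have h1 : b = d + 1 ↔ d = b + 1 := by revert b d; decide
  have h2 : ∀ v, d + 1 = b + v ↔ d = b + 1 + v := by revert b d; decide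
  rcases hR with rfl | rfl | ⟨s, hs, hs', rfl⟩ | ⟨e, rfl⟩
  · simp [h1, eq_comm]
  · simp only [Set.mem_ofPred_eq, flipPt_mk, mem_relT, h2]
  · simp
  · simp [add_assoc, h2]

theorem card_relTilde_relTilde (s t : Set (X × X)) (x y : X) (a b c d : ZMod 2) :
    Nat.card {r // ((x, a, b), r) ∈ relTilde s ∧ (r, (y, c, d)) ∈ relTilde t} =
      if a = c then Nat.card {z // (x, z) ∈ s ∧ (z, y) ∈ t} * 2 else 0 := by
  split_ifs with h
  · subst h
    conv_rhs => rw [← Nat.card_zmod 2]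
    rw [← Nat.card_prod]
    refine Nat.card_congr
      ⟨fun r => (⟨r.1.1, ?_⟩, r.1.2.2), fun z => ⟨(z.1.1, a, z.2), ?_⟩, ?_, ?_⟩
    · obtain ⟨⟨z, e, f⟩, h1, h2⟩ := r
      rw [mem_relTilde] at h1 h2
      exact ⟨h1.2, h2.2⟩
    · rw [mem_relTilde, mem_relTilde]
      exact ⟨⟨rfl, z.1.2.1⟩, rfl, z.1.2.2⟩
    · rintro ⟨⟨z, e, f⟩, h1, h2⟩
      rw [mem_relTilde] at h1
      simp [h1.1]
    · intro z
      rfl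
  · have : IsEmpty {r // ((x, a, b), r) ∈ relTilde s ∧ (r, (y, c, d)) ∈ relTilde t} := by
      refine ⟨?_⟩
      rintro ⟨⟨z, e, f⟩, h1, h2⟩
      rw [mem_relTilde] at h1 h2
      exact h (h1.1.trans h2.1)
    exact Nat.card_of_isEmpty

theorem card_relTilde_crossRel (s : Set (X × X)) (e : ZMod 2) (x y : X) (a b c d : ZMod 2) :
    Nat.card {r // ((x, a, b), r) ∈ relTilde s ∧ (r, (y, c, d)) ∈ crossRel H e} =
      if a = c then 0 else Nat.card {z // (x, z) ∈ s} := by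
  split_ifs with h
  · have : IsEmpty {r // ((x, a, b), r) ∈ relTilde s ∧ (r, (y, c, d)) ∈ crossRel H e} := by
      refine ⟨?_⟩
      rintro ⟨⟨z, e, f⟩, h1, h2⟩
      rw [mem_relTilde] at h1
      rw [mem_crossRel] at h2
      exact h2.1 (h1.1.symm.trans h)
    exact Nat.card_of_isEmpty
  · refine Nat.card_congr
      ⟨fun r => ⟨r.1.1, ?_⟩, fun z => ⟨(z.1, a, d - e - signBit H a z.1 y), ?_⟩, ?_, ?_⟩
    · obtain ⟨⟨z, e, f⟩, h1, h2⟩ := r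
      rw [mem_relTilde] at h1
      exact h1.2
    · rw [mem_relTilde, mem_crossRel]
      exact ⟨⟨rfl, z.2⟩, h, by ring⟩
    · rintro ⟨⟨z, i, f⟩, h1, h2⟩
      rw [mem_relTilde] at h1
      rw [mem_crossRel] at h2
      obtain ⟨rfl, -⟩ := h1
      simp only [Subtype.mk.injEq, Prod.mk.injEq, true_and]
      rw [h2.2]
      ring
    · intro z
      rfl

theorem card_crossRel_relTilde (t : Set (X × X)) (e : ZMod 2) (x y : X) (a b c d : ZMod 2) :
    Nat.card {r // ((x, a, b), r) ∈ crossRel H e ∧ (r, (y, c, d)) ∈ relTilde t} =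
      if a = c then 0 else Nat.card {z // (z, y) ∈ t} := by
  split_ifs with h
  · have : IsEmpty {r // ((x, a, b), r) ∈ crossRel H e ∧ (r, (y, c, d)) ∈ relTilde t} := by
      refine ⟨?_⟩
      rintro ⟨⟨z, e, f⟩, h1, h2⟩
      rw [mem_relTilde] at h2
      rw [mem_crossRel] at h1
      exact h1.1 (h.trans h2.1.symm)
    exact Nat.card_of_isEmpty
  · refine Nat.card_congr
      ⟨fun r => ⟨r.1.1, ?_⟩, fun z => ⟨(z.1, c, b + signBit H a x z.1 + e), ?_⟩, ?_, ?_⟩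
    · obtain ⟨⟨z, e, f⟩, h1, h2⟩ := r
      rw [mem_relTilde] at h2
      exact h2.2
    · rw [mem_relTilde, mem_crossRel]
      exact ⟨⟨h, rfl⟩, rfl, z.2⟩
    · rintro ⟨⟨z, i, f⟩, h1, h2⟩
      rw [mem_relTilde] at h2
      rw [mem_crossRel] at h1
      obtain ⟨rfl, -⟩ := h2
      simp only [Subtype.mk.injEq, Prod.mk.injEq, true_and]
      rw [h1.2]
    · intro z
      rfl

/-- A path from `x_{ab}` to `y_{ad}` through the other half is determined by the point `z` below its
middle vertex, and exists if and only if `H_{xz} H_{yz}` (with `Hᵀ` for `H` if `a = 1`) has the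
prescribed sign. -/
theorem card_crossRel_crossRel (e f : ZMod 2) (x y : X) (a b c d : ZMod 2) :
    Nat.card {r // ((x, a, b), r) ∈ crossRel H e ∧ (r, (y, c, d)) ∈ crossRel H f} =
      if a = c then Nat.card {z // signBit H a x z + signBit H a y z = b + d + e + f} else 0 := by
  have h2 : ∀ a : ZMod 2, a ≠ a + 1 := by simp
  split_ifs with h
  · subst h
    have key : ∀ b d e f v w : ZMod 2, v + w = b + d + e + f ↔ d = b + v + e + w + f := by decide
    refine Nat.card_congr
      ⟨fun r => ⟨r.1.1, ?_⟩, fun z => ⟨(z.1, a + 1, b + signBit H a x z.1 + e), ?_⟩, ?_, ?_⟩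
    · obtain ⟨⟨z, i, j⟩, h1, h2⟩ := r
      rw [mem_crossRel] at h1 h2
      change signBit H a x z + signBit H a y z = _
      rw [key, h2.2, h1.2, signBit_symm h2.1]
    · rw [mem_crossRel, mem_crossRel, signBit_symm (h2 a).symm, ← key]
      exact ⟨⟨h2 a, rfl⟩, (h2 a).symm, z.2⟩
    · rintro ⟨⟨z, i, j⟩, h1, h3⟩
      rw [mem_crossRel] at h1
      have : a + 1 = i := ZMod.two_eq_of_ne_of_ne (h2 a).symm h1.1.symm
      simp only [Subtype.mk.injEq, Prod.mk.injEq, true_and]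
      exact ⟨this, h1.2.symm⟩
    · intro z
      rfl
  · have : IsEmpty {r // ((x, a, b), r) ∈ crossRel H e ∧ (r, (y, c, d)) ∈ crossRel H f} := by
      refine ⟨?_⟩
      rintro ⟨⟨z, i, f⟩, h1, h2⟩
      rw [mem_crossRel] at h1 h2
      exact h (ZMod.two_eq_of_ne_of_ne h1.1 h2.1.symm)
    exact Nat.card_of_isEmpty

/-- Two distinct rows of a Hadamard matrix agree in exactly half of the columns. -/
theorem card_signBit_add_eq_of_ne [Fintype X] [DecidableEq X] (hH : H.IsHadamard) (a e : ZMod 2)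
    {x y : X} (hxy : x ≠ y) :
    Nat.card {z // signBit H a x z + signBit H a y z = e} = Fintype.card X / 2 := by
  have hsum : ∑ z, (-1 : ℤ) ^ (signBit H a x z + signBit H a y z).val = 0 := by
    have h := congrFun₂ (transposeIf_isHadamard hH a).mul_conjTranspose x y
    simpa [Matrix.mul_apply, hxy, neg_one_pow_val_add,
      ← transposeIf_eq_neg_one_pow hH.eq_one_or_neg_one] using h
  have hsplit : ∀ v : ZMod 2,
      (-1 : ℤ) ^ v.val = (if v = 0 then 1 else 0) - if v = 1 then 1 else 0 := by
    decide
  have htot : ∀ v : ZMod 2, (1 : ℕ) = (if v = 0 then 1 else 0) + if v = 1 then 1 else 0 := by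
    decide
  have hcard : Fintype.card X =
      ∑ z : X, ((if signBit H a x z + signBit H a y z = 0 then 1 else 0) +
        if signBit H a x z + signBit H a y z = 1 then 1 else 0) := by
    simp_rw [← htot]
    simp
  simp_rw [hsplit] at hsum
  rw [Finset.sum_sub_distrib, ← Finset.natCast_card_filter, ← Finset.natCast_card_filter] at hsum
  rw [Finset.sum_add_distrib, ← Finset.card_filter, ← Finset.card_filter] at hcard
  rw [Nat.card_eq_fintype_card, Fintype.card_subtype]
  rcases (by revert e; decide : e = 0 ∨ e = 1) with rfl | rfl <;> omega

theorem IsAssociationScheme.exists_card_out (hS : IsAssociationScheme S) {s : Set (X × X)}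
    (hs : s ∈ S) : ∃ c : ℕ, ∀ x, Nat.card {z // (x, z) ∈ s} = c := by
  obtain ⟨c, hc⟩ := hS.intersection s hs _ (hS.reverse_mem s hs) _ hS.diag_mem
  refine ⟨c, fun x => ?_⟩
  simpa using hc x x rfl

theorem IsAssociationScheme.exists_card_in (hS : IsAssociationScheme S) {s : Set (X × X)}
    (hs : s ∈ S) : ∃ c : ℕ, ∀ x, Nat.card {z // (z, x) ∈ s} = c :=
  hS.exists_card_out (hS.reverse_mem s hs)

theorem hadamardScheme_isAssociationScheme [Fintype X] [DecidableEq X] [Nonempty X]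
    (hS : IsAssociationScheme S) (hH : H.IsHadamard) :
    IsAssociationScheme (hadamardScheme S H) := by
  have hH1 := hH.eq_one_or_neg_one
  have hP := hadamardScheme_isPartition hS hH1
  refine ⟨hP, (mem_hadamardScheme hH1).2 (Or.inl rfl),
    fun s hs => hadamardScheme_reverse_mem hS hH1 hs, fun s hs t ht u hu => ?_⟩
  rcases (mem_hadamardScheme hH1).1 hs with rfl | rfl | ⟨s, hs1, hs', rfl⟩ | ⟨e, rfl⟩
  · exact exists_card_eq_of_graph_left hP id (fun p q => eq_comm) ht hu
  · exact exists_card_eq_of_graph_left hP flipPt mem_relT_iff_eq_flipPt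
      (hadamardScheme_flip_left_mem hH1 ht) hu
  all_goals
    rcases (mem_hadamardScheme hH1).1 ht with rfl | rfl | ⟨t, ht1, ht', rfl⟩ | ⟨f, rfl⟩
    · exact exists_card_eq_of_graph_right hP id (fun p q => Iff.rfl) hs hu
    · refine exists_card_eq_of_graph_right hP flipPt (fun p q => ?_)
        (hadamardScheme_flip_right_mem hH1 hs) hu
      rw [mem_relT_iff_eq_flipPt]
      exact ⟨fun h => by rw [h, flipPt_flipPt], fun h => by rw [h, flipPt_flipPt]⟩
  all_goals
    simp only [Prod.forall, card_relTilde_relTilde, card_relTilde_crossRel,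
      card_crossRel_relTilde, card_crossRel_crossRel]
    rw [mem_hadamardScheme hH1] at hu
  · rcases hu with rfl | rfl | ⟨u, hu, hu', rfl⟩ | ⟨g, rfl⟩
    · obtain ⟨c, hc⟩ := hS.intersection s hs1 t ht1 _ hS.diag_mem
      refine ⟨c * 2, fun x a b y c d h => ?_⟩
      simp only [Set.mem_ofPred_eq, Prod.mk.injEq] at h
      rw [if_pos h.2.1, hc x y h.1]
    · obtain ⟨c, hc⟩ := hS.intersection s hs1 t ht1 _ hS.diag_mem
      refine ⟨c * 2, fun x a b y c d h => ?_⟩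
      rw [mem_relT] at h
      rw [if_pos h.2.1, hc x y h.1]
    · obtain ⟨c, hc⟩ := hS.intersection s hs1 t ht1 u hu
      refine ⟨c * 2, fun x a b y c d h => ?_⟩
      rw [mem_relTilde] at h
      rw [if_pos h.1, hc x y h.2]
    · refine ⟨0, fun x a b y c d h => ?_⟩
      rw [mem_crossRel] at h
      rw [if_neg h.1]
  · obtain ⟨n, hn⟩ := hS.exists_card_out hs1
    rcases hu with rfl | rfl | ⟨u, hu, hu', rfl⟩ | ⟨g, rfl⟩
    · exact ⟨0, fun x a b y c d h => if_pos (by simp_all)⟩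
    · exact ⟨0, fun x a b y c d h => if_pos (mem_relT.1 h).2.1⟩
    · exact ⟨0, fun x a b y c d h => if_pos (mem_relTilde.1 h).1⟩
    · exact ⟨n, fun x a b y c d h => by rw [if_neg (mem_crossRel.1 h).1, hn]⟩
  · obtain ⟨n, hn⟩ := hS.exists_card_in ht1
    rcases hu with rfl | rfl | ⟨u, hu, hu', rfl⟩ | ⟨g, rfl⟩
    · exact ⟨0, fun x a b y c d h => if_pos (by simp_all)⟩
    · exact ⟨0, fun x a b y c d h => if_pos (mem_relT.1 h).2.1⟩
    · exact ⟨0, fun x a b y c d h => if_pos (mem_relTilde.1 h).1⟩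
    · exact ⟨n, fun x a b y c d h => by rw [if_neg (mem_crossRel.1 h).1, hn]⟩
  · rcases hu with rfl | rfl | ⟨u, hu, hu', rfl⟩ | ⟨g, rfl⟩
    · refine ⟨Nat.card {z : X // 0 = e + f}, fun x a b y c d h => ?_⟩
      simp only [Set.mem_ofPred_eq, Prod.mk.injEq] at h
      obtain ⟨rfl, rfl, rfl⟩ := h
      simp only [if_true, CharTwo.add_self_eq_zero, zero_add]
    · refine ⟨Nat.card {z : X // 0 = 1 + e + f}, fun x a b y c d h => ?_⟩
      rw [mem_relT] at h
      obtain ⟨rfl, rfl, rfl⟩ := h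
      simp only [if_true, ← add_assoc, CharTwo.add_self_eq_zero, zero_add]
    · refine ⟨Fintype.card X / 2, fun x a b y c d h => ?_⟩
      rw [mem_relTilde] at h
      rw [if_pos h.1, card_signBit_add_eq_of_ne hH a _ (hS.ne_of_mem hu hu' h.2)]
    · exact ⟨0, fun x a b y c d h => if_neg (mem_crossRel.1 h).1⟩

theorem Matrix.IsHadamard.negRow [Fintype X] [DecidableEq X] (hH : H.IsHadamard) (z : X) :
    (Matrix.of fun x y => if x = z then -H x y else H x y).IsHadamard := by
  set d : X → ℤ := fun x => if x = z then -1 else 1 with hd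
  have hdd : Matrix.diagonal d * Matrix.diagonal d = 1 := by
    rw [Matrix.diagonal_mul_diagonal, ← Matrix.diagonal_one]
    congr 1
    ext x
    by_cases h : x = z <;> simp [hd, h]
  have hdT : (Matrix.diagonal d).conjTranspose = Matrix.diagonal d := by
    simp
  have hdH : (Matrix.of fun x y => if x = z then -H x y else H x y) = Matrix.diagonal d * H := by
    ext x y
    by_cases h : x = z <;> simp [hd, h]
  refine ⟨fun x y => ?_, ?_, ?_⟩
  · have := hH.apply_mem x y
    simp only [Matrix.of_apply]
    split_ifs
    · simpa [Unitary.mem_iff] using this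
    · exact this
  · rw [hdH, Matrix.conjTranspose_mul, hdT, Matrix.mul_assoc, ← Matrix.mul_assoc H,
      hH.mul_conjTranspose, Matrix.smul_mul, Matrix.one_mul, Matrix.mul_smul, hdd]
  · rw [hdH, Matrix.conjTranspose_mul, hdT, Matrix.mul_assoc, ← Matrix.mul_assoc _ _ H, hdd,
      Matrix.one_mul, hH.conjTranspose_mul]

theorem HadamardEquivalent.isHadamard [Fintype X] [DecidableEq X] {H' : Matrix X X ℤ}
    (h : HadamardEquivalent H H') (hH : H.IsHadamard) : H'.IsHadamard := by
  induction h with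
  | refl => exact hH
  | tail _ hstep ih =>
    cases hstep with
    | permRows σ => exact (Matrix.isHadamard_submatrix_equiv_iff σ (Equiv.refl X)).2 ih
    | permCols τ => exact (Matrix.isHadamard_submatrix_equiv_iff (Equiv.refl X) τ).2 ih
    | negRow z => exact ih.negRow z
    | negCol z => exact (ih.transpose.negRow z).transpose

end

/-! ### Isomorphisms between the schemes -/

section
variable {X Y : Type*} {S : Set (Set (X × X))} {T : Set (Set (Y × Y))} {H H' : Matrix X X ℤ}

theorem SchemeIso.mem_iff (hS : IsAssociationScheme S) (hT : IsAssociationScheme T)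
    (f : SchemeIso S T) (s : S) (x y : X) :
    (f.onPoints x, f.onPoints y) ∈ (f.onRels s).1 ↔ (x, y) ∈ s.1 := by
  refine ⟨fun h => ?_, f.map_mem s x y⟩
  obtain ⟨t, ht, hmem⟩ := hS.exists_mem (x, y)
  have h1 := f.map_mem ⟨t, ht⟩ x y hmem
  have h2 := f.onRels.injective (Subtype.ext (hT.eq_of_mem (Subtype.prop _) (Subtype.prop _) h1 h))
  rw [← h2]
  exact hmem

/-- On a finite scheme, a permutation of the points that maps each relation into some relation
underlies an automorphism of the scheme. -/
theorem IsAssociationScheme.exists_schemeIso [Finite X] (hS : IsAssociationScheme S)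
    (σ : Equiv.Perm X) (φ : S → S) (h : ∀ (s : S) (x y : X), (x, y) ∈ s.1 → (σ x, σ y) ∈ (φ s).1) :
    ∃ f : SchemeIso S S, f.onPoints = σ ∧ ∀ s, f.onRels s = φ s := by
  have hsurj : Function.Surjective φ := by
    intro t
    obtain ⟨⟨x, y⟩, hxy⟩ := Setoid.nonempty_of_mem_partition hS.partition t.2
    obtain ⟨s, hs, hmem⟩ := hS.exists_mem (σ.symm x, σ.symm y)
    have h1 := h ⟨s, hs⟩ _ _ hmem
    simp only [Equiv.apply_symm_apply] at h1
    exact ⟨⟨s, hs⟩, Subtype.ext (hS.eq_of_mem (Subtype.prop _) t.2 h1 hxy)⟩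
  have hbij : Function.Bijective φ := ⟨Finite.injective_iff_surjective.2 hsurj, hsurj⟩
  exact ⟨⟨σ, Equiv.ofBijective φ hbij, h⟩, rfl, fun _ => rfl⟩

theorem flipPt_mem_relTilde {s : Set (X × X)} {p q : TildePt X} :
    (p, flipPt q) ∈ relTilde s ↔ (p, q) ∈ relTilde s := by
  obtain ⟨x, a, b⟩ := p
  obtain ⟨y, c, d⟩ := q
  simp

theorem flipPt_notMem_crossRel {e : ZMod 2} {p q : TildePt X} (h : (p, q) ∈ crossRel H e) :
    (p, flipPt q) ∉ crossRel H e := by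
  obtain ⟨x, a, b⟩ := p
  obtain ⟨y, c, d⟩ := q
  rw [mem_crossRel] at h
  rw [flipPt_mk, mem_crossRel, ← h.2]
  simp

theorem eq_or_eq_flipPt {p q : TildePt X} (h1 : p.1 = q.1) (h2 : p.2.1 = q.2.1) :
    p = q ∨ p = flipPt q := by
  obtain ⟨x, a, b⟩ := p
  obtain ⟨y, c, d⟩ := q
  obtain rfl : x = y := h1
  obtain rfl : a = c := h2
  simp only [flipPt_mk, Prod.mk.injEq, true_and]
  revert b d
  decide

/-- Among the relations other than the diagonal, `t̃` is the only one with a single out-neighbour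
at each point, so it is preserved by isomorphisms. -/
theorem SchemeIso.onPoints_flipPt [Nontrivial X]
    (hH : ∀ x y, H x y = 1 ∨ H x y = -1) (hH' : ∀ x y, H' x y = 1 ∨ H' x y = -1)
    (hR : IsAssociationScheme (hadamardScheme S H))
    (hR' : IsAssociationScheme (hadamardScheme S H'))
    (f : SchemeIso (hadamardScheme S H) (hadamardScheme S H')) (p : TildePt X) :
    f.onPoints (flipPt p) = flipPt (f.onPoints p) := by
  obtain ⟨Q, hQ⟩ : ∃ Q, Q = f.onRels ⟨relT X, (mem_hadamardScheme hH).2 (Or.inr (Or.inl rfl))⟩ :=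
    ⟨_, rfl⟩
  have hiff : ∀ q, (f.onPoints p, q) ∈ Q.1 ↔ q = f.onPoints (flipPt p) := by
    intro q
    obtain ⟨q, rfl⟩ := f.onPoints.surjective q
    rw [hQ, f.mem_iff hR hR', mem_relT_iff_eq_flipPt, f.onPoints.apply_eq_iff_eq]
  have hmem := (hiff _).2 rfl
  rcases (mem_hadamardScheme hH').1 Q.2 with h | h | ⟨s, -, -, h⟩ | ⟨e, h⟩ <;> rw [h] at hmem hiff
  · exact absurd (f.onPoints.injective hmem).symm (flipPt_ne p)
  · exact (mem_relT_iff_eq_flipPt _ _).1 hmem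
  · exact absurd ((hiff _).1 (flipPt_mem_relTilde.2 hmem)) (flipPt_ne _)
  · obtain ⟨y, z, hyz⟩ := exists_pair_ne X
    generalize f.onPoints p = q at hiff
    obtain ⟨x, a, b⟩ := q
    have hc : a ≠ a + 1 := by simp
    have h1 := (hiff (y, a + 1, _)).1 (mem_crossRel.2 ⟨hc, rfl⟩)
    have h2 := (hiff (z, a + 1, _)).1 (mem_crossRel.2 ⟨hc, rfl⟩)
    exact absurd (congrArg Prod.fst (h1.trans h2.symm)) hyz

/-- The relations `s̃` are those that are unchanged by composition with `t̃`, so isomorphisms permute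
them. -/
theorem SchemeIso.exists_onRels_relTilde [Nontrivial X] (hS : IsAssociationScheme S)
    (hH : ∀ x y, H x y = 1 ∨ H x y = -1) (hH' : ∀ x y, H' x y = 1 ∨ H' x y = -1)
    (hR : IsAssociationScheme (hadamardScheme S H))
    (hR' : IsAssociationScheme (hadamardScheme S H'))
    (f : SchemeIso (hadamardScheme S H) (hadamardScheme S H')) {s : Set (X × X)} (hs : s ∈ S)
    (hne : s ≠ {p | p.1 = p.2}) :
    ∃ t ∈ S, ∀ p q, (p, q) ∈ relTilde s → (f.onPoints p, f.onPoints q) ∈ relTilde t := by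
  set Q := f.onRels ⟨relTilde s,
    (mem_hadamardScheme hH).2 (Or.inr (Or.inr (Or.inl ⟨s, hs, hne, rfl⟩)))⟩ with hQ
  have h1 : ∀ p q, (p, q) ∈ relTilde s → (f.onPoints p, f.onPoints q) ∈ Q.1 :=
    fun p q h => f.map_mem _ _ _ h
  obtain ⟨⟨x, y⟩, hxy⟩ := Setoid.nonempty_of_mem_partition hS.partition hs
  have hpq : ((x, 0, 0), (y, 0, 0)) ∈ relTilde s := mem_relTilde.2 ⟨rfl, hxy⟩
  have h2 := h1 _ _ hpq
  have h3 := h1 _ _ (flipPt_mem_relTilde.2 hpq)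
  rw [f.onPoints_flipPt hH hH' hR hR'] at h3
  rcases (mem_hadamardScheme hH').1 Q.2 with h | h | ⟨t, ht, -, h⟩ | ⟨e, h⟩ <;> rw [h] at h2 h3
  · exact absurd (Eq.trans (Eq.symm h3) h2) (flipPt_ne _)
  · rw [mem_relT_iff_eq_flipPt] at h2 h3
    exact absurd (h3.trans h2.symm) (flipPt_ne _)
  · exact ⟨t, ht, fun p q hpq => h ▸ h1 p q hpq⟩
  · exact absurd h3 (flipPt_notMem_crossRel h2)

/-- Two points `x_{ab}`, `y_{cd}` with `a = c` lie in `1`, in `t̃` or in some `s̃`, and isomorphisms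
preserve this family of relations. -/
theorem SchemeIso.half_eq_of_half_eq [Nontrivial X] (hS : IsAssociationScheme S)
    (hH : ∀ x y, H x y = 1 ∨ H x y = -1) (hH' : ∀ x y, H' x y = 1 ∨ H' x y = -1)
    (hR : IsAssociationScheme (hadamardScheme S H))
    (hR' : IsAssociationScheme (hadamardScheme S H'))
    (f : SchemeIso (hadamardScheme S H) (hadamardScheme S H')) {p q : TildePt X}
    (h : p.2.1 = q.2.1) : (f.onPoints p).2.1 = (f.onPoints q).2.1 := by
  by_cases hxy : p.1 = q.1
  · rcases eq_or_eq_flipPt hxy h with rfl | rfl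
    · rfl
    · rw [f.onPoints_flipPt hH hH' hR hR']
      rfl
  · obtain ⟨s, hs, hmem⟩ := hS.exists_mem (p.1, q.1)
    obtain ⟨t, ht, htt⟩ := f.exists_onRels_relTilde hS hH hH' hR hR' hs
      (by rintro rfl; exact hxy hmem)
    exact (mem_relTilde.1 (htt p q (mem_relTilde.2 ⟨h, hmem⟩))).1

/-- An isomorphism from `S(H)` to `S(H')` either preserves or exchanges the two halves, and on them
it induces two automorphisms of `(X, S)` that differ by an element of `Aut(X, S)`. With
respect to these, `H'` or its transpose arises from `H` by negating rows and columns. -/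
theorem SchemeIso.exists_signBit_eq [Finite X] [Nontrivial X] (hS : IsAssociationScheme S)
    (hH : ∀ x y, H x y = 1 ∨ H x y = -1) (hH' : ∀ x y, H' x y = 1 ∨ H' x y = -1)
    (hR : IsAssociationScheme (hadamardScheme S H))
    (hR' : IsAssociationScheme (hadamardScheme S H'))
    (φ : SchemeIso (hadamardScheme S H) (hadamardScheme S H')) :
    ∃ (d : ZMod 2 × SchemeIso S S × SchemeAut S) (u v : X → ZMod 2), ∀ x y,
      signBit H' d.1 (d.2.1.onPoints x) (d.2.2.1.onPoints (d.2.1.onPoints y)) =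
        signBit H 0 x y + u x + v y := by
  obtain ⟨x₀⟩ := (inferInstance : Nonempty X)
  set π : ZMod 2 := (φ.onPoints (x₀, 0, 0)).2.1 with hπ
  have hhalf : ∀ p q, (φ.onPoints p).2.1 = (φ.onPoints q).2.1 ↔ p.2.1 = q.2.1 := by
    refine fun p q => ⟨fun h => ?_, φ.half_eq_of_half_eq hS hH hH' hR hR'⟩
    have := (φ.symm hR hR').half_eq_of_half_eq hS hH' hH hR' hR h
    simpa [SchemeIso.symm] using this
  have hπa : ∀ x a b, (φ.onPoints (x, a, b)).2.1 = π + a := by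
    intro x a b
    have h1 := hhalf (x, a, b) (x₀, 0, 0)
    rw [← hπ] at h1
    simp only at h1
    have key : ∀ a c π : ZMod 2, (c = π ↔ a = 0) → c = π + a := by decide
    exact key _ _ _ h1
  set σ : ZMod 2 → X → X := fun a x => (φ.onPoints (x, a, 0)).1 with hσ
  have hinj : ∀ a, Function.Injective (σ a) := by
    intro a x y h
    rcases eq_or_eq_flipPt h (by rw [hπa, hπa]) with h1 | h1
    · exact congrArg Prod.fst (φ.onPoints.injective h1)
    · rw [← φ.onPoints_flipPt hH hH' hR hR'] at h1
      exact congrArg Prod.fst (φ.onPoints.injective h1)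
  have hrel : ∀ s : S, ∃ t : S, ∀ a x y, (x, y) ∈ s.1 → (σ a x, σ a y) ∈ t.1 := by
    rintro ⟨s, hs⟩
    by_cases hne : s = {p | p.1 = p.2}
    · refine ⟨⟨s, hs⟩, fun a x y hxy => ?_⟩
      subst hne
      exact congrArg (σ a) hxy
    · obtain ⟨t, ht, htt⟩ := φ.exists_onRels_relTilde hS hH hH' hR hR' hs hne
      exact ⟨⟨t, ht⟩, fun a x y hxy =>
        (mem_relTilde.1 (htt (x, a, 0) (y, a, 0) (mem_relTilde.2 ⟨rfl, hxy⟩))).2⟩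
  choose ψ hψ using hrel
  have hiso : ∀ a, ∃ f : SchemeIso S S, (∀ x, f.onPoints x = σ a x) ∧ ∀ s, f.onRels s = ψ s := by
    intro a
    obtain ⟨f, hf, hf'⟩ := hS.exists_schemeIso
      (Equiv.ofBijective (σ a) (Finite.injective_iff_bijective.1 (hinj a))) ψ
      (fun s x y h => hψ s a x y h)
    exact ⟨f, fun x => by rw [hf]; rfl, hf'⟩
  obtain ⟨f, hf, hf'⟩ := hiso 0
  obtain ⟨g, hg, hg'⟩ := hiso 1
  refine ⟨(π, f, ⟨(f.symm hS hS).trans g, fun s => ?_⟩), ?_⟩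
  · change g.onRels (f.onRels.symm s) = s
    rw [hg', ← hf', Equiv.apply_symm_apply]
  -- `r¹_H` is mapped to one of the two relations between the halves.
  set Q := φ.onRels ⟨crossRel H 0,
    (mem_hadamardScheme hH).2 (Or.inr (Or.inr (Or.inr ⟨0, rfl⟩)))⟩ with hQ
  have hmem : ∀ p q, (p, q) ∈ crossRel H 0 → (φ.onPoints p, φ.onPoints q) ∈ Q.1 :=
    fun p q h => φ.map_mem _ _ _ h
  obtain ⟨e, he⟩ : ∃ e, Q.1 = crossRel H' e := by
    have h1 := hmem (x₀, 0, 0) (x₀, 1, _) (mem_crossRel.2 ⟨by decide, rfl⟩)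
    have h2 : (φ.onPoints (x₀, 0, 0)).2.1 ≠ (φ.onPoints (x₀, 1, 0 + signBit H 0 x₀ x₀ + 0)).2.1 :=
      fun h => absurd ((hhalf _ _).1 h) (zero_ne_one' (ZMod 2))
    rcases (mem_hadamardScheme hH').1 Q.2 with h | h | ⟨t, ht, -, h⟩ | h
    · rw [h] at h1
      exact absurd (congrArg (fun p => p.2.1) h1) h2
    · rw [h] at h1
      exact absurd (mem_relT.1 h1).2.1 h2
    · rw [h] at h1
      exact absurd (mem_relTilde.1 h1).1 h2
    · exact h
  have hval : ∀ x a b, φ.onPoints (x, a, b) = (σ a x, π + a, b + (φ.onPoints (x, a, 0)).2.2) := by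
    intro x a b
    rcases (by revert b; decide : b = 0 ∨ b = 1) with rfl | rfl
    · rw [← hπa x a 0, zero_add]
    · have := φ.onPoints_flipPt hH hH' hR hR' (x, a, 0)
      rw [flipPt_mk, zero_add] at this
      rw [this, ← hπa x a 0, add_comm]
      rfl
  refine ⟨fun x => (φ.onPoints (x, 0, 0)).2.2 + e, fun y => (φ.onPoints (y, 1, 0)).2.2,
    fun x y => ?_⟩
  have h1 := hmem (x, 0, 0) (y, 1, _) (mem_crossRel.2 ⟨by decide, rfl⟩)
  rw [he, hval, hval y, mem_crossRel] at h1
  have h2 : ((f.symm hS hS).trans g).onPoints (f.onPoints y) = σ 1 y := by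
    rw [← hg]
    simp [SchemeIso.symm, SchemeIso.trans]
  have h3 := h1.2
  simp only [add_zero, zero_add] at h3
  have key : ∀ v₁ v₂ v₃ v₄ e : ZMod 2, v₂ + v₄ = v₃ + v₁ + e → v₁ = v₂ + (v₃ + e) + v₄ := by decide
  change signBit H' π (f.onPoints x) (((f.symm hS hS).trans g).onPoints (f.onPoints y)) = _
  rw [h2, hf]
  exact key _ _ _ _ _ h3

/-- A matrix normalized at `x₀` is determined by its values up to negation of rows and columns. -/
theorem eq_of_signBit_eq {H₁ H₂ : Matrix X X ℤ} {x₀ : X}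
    (hH₁ : ∀ x y, H₁ x y = 1 ∨ H₁ x y = -1) (hH₂ : ∀ x y, H₂ x y = 1 ∨ H₂ x y = -1)
    (hn₁ : IsNormalizedAt H₁ x₀) (hn₂ : IsNormalizedAt H₂ x₀) (a : ZMod 2) (σ τ : Equiv.Perm X)
    (w : X → X → ZMod 2) {u₁ v₁ u₂ v₂ : X → ZMod 2}
    (h₁ : ∀ x y, signBit H₁ a (σ x) (τ y) = w x y + u₁ x + v₁ y)
    (h₂ : ∀ x y, signBit H₂ a (σ x) (τ y) = w x y + u₂ x + v₂ y) : H₁ = H₂ := by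
  have hz : ∀ {K : Matrix X X ℤ}, IsNormalizedAt K x₀ → ∀ z,
      signBit K a x₀ z = 0 ∧ signBit K a z x₀ = 0 := by
    intro K hK z
    unfold signBit transposeIf
    split_ifs <;> simp_all [IsNormalizedAt]
  -- The difference of the exponents has the form `u x + v y` and vanishes in one row and one
  -- column, hence everywhere.
  have hd : ∀ x y, signBit H₁ a (σ x) (τ y) - signBit H₂ a (σ x) (τ y) =
      (u₁ x - u₂ x) + (v₁ y - v₂ y) := by
    intro x y
    rw [h₁, h₂]
    ring
  have hb : ∀ x y, signBit H₁ a x y = signBit H₂ a x y := by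
    intro x y
    have e1 := hd (σ.symm x) (τ.symm y)
    have e2 := hd (σ.symm x) (τ.symm x₀)
    have e3 := hd (σ.symm x₀) (τ.symm y)
    have e4 := hd (σ.symm x₀) (τ.symm x₀)
    simp only [Equiv.apply_symm_apply, (hz hn₁ _).1, (hz hn₁ _).2, (hz hn₂ _).1,
      (hz hn₂ _).2] at e1 e2 e3 e4
    rw [← sub_eq_zero]
    linear_combination e1 - e2 - e3 + e4
  have ht : transposeIf H₁ a = transposeIf H₂ a := by
    ext x y
    rw [transposeIf_eq_neg_one_pow hH₁, transposeIf_eq_neg_one_pow hH₂, hb]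
  unfold transposeIf at ht
  split_ifs at ht
  · exact ht
  · exact Matrix.transpose_injective ht

end

/-! ### Counting -/

section
variable {X : Type*} {S : Set (Set (X × X))}

theorem card_perm_fixing [Fintype X] [DecidableEq X] (x₀ : X) :
    Nat.card {σ : Equiv.Perm X // σ x₀ = x₀} = (Fintype.card X - 1).factorial := by
  have e : {σ : Equiv.Perm X // ∀ a, ¬a ≠ x₀ → σ a = a} ≃ {σ : Equiv.Perm X // σ x₀ = x₀} :=
    Equiv.subtypeEquivRight fun σ => by simp
  rw [← Nat.card_congr ((Equiv.Perm.subtypeEquivSubtypePerm (· ≠ x₀)).trans e), Nat.card_perm,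
    Nat.card_eq_fintype_card, Fintype.card_subtype_compl, Fintype.card_subtype_eq]

instance [Finite X] : Finite (SchemeIso S S) :=
  Finite.of_injective (fun f => (f.onPoints, f.onRels)) fun f g h => by
    simp only [Prod.mk.injEq] at h
    exact SchemeIso.ext h.1 h.2

instance [Finite X] : Finite (SchemeAut S) :=
  Finite.of_injective (fun f : SchemeAut S => f.1) Subtype.val_injective

instance [Finite X] [DecidableEq X] (H₀ : Matrix X X ℤ) : Finite (SchemeFamily S H₀) :=
  Finite.of_injective (fun R : SchemeFamily S H₀ => R.1) Subtype.val_injective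

/-- The matrix `P_σ⁻¹ H P_τ` for permutations `σ`, `τ` that fix `x₀`. -/
def permuted {x₀ : X} (H : Matrix X X ℤ)
    (g : {σ : Equiv.Perm X // σ x₀ = x₀} × {τ : Equiv.Perm X // τ x₀ = x₀}) : Matrix X X ℤ :=
  H.submatrix g.1.1 g.2.1

theorem IsNormalizedAt.permuted {H : Matrix X X ℤ} {x₀ : X} (h : IsNormalizedAt H x₀)
    (g : {σ : Equiv.Perm X // σ x₀ = x₀} × {τ : Equiv.Perm X // τ x₀ = x₀}) :
    IsNormalizedAt (permuted H g) x₀ := by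
  intro x
  simp [_root_.permuted, g.1.2, g.2.2, (h _).1, (h _).2]

theorem hadamardEquivalent_permuted [DecidableEq X] {x₀ : X} (H : Matrix X X ℤ)
    (g : {σ : Equiv.Perm X // σ x₀ = x₀} × {τ : Equiv.Perm X // τ x₀ = x₀}) :
    HadamardEquivalent H (permuted H g) :=
  (Relation.ReflTransGen.single (HadamardStep.permRows H g.1.1)).tail
    (HadamardStep.permCols _ g.2.1)

/-- The pairs `(σ, τ)` that give the same matrix form a coset of `Aut_{x₀}(H)`. -/
theorem card_permuted_fiber_le [Finite X] (H K : Matrix X X ℤ) (x₀ : X) :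
    Nat.card {g : {σ : Equiv.Perm X // σ x₀ = x₀} × {τ : Equiv.Perm X // τ x₀ = x₀} //
      permuted H g = K} ≤ Nat.card (HadamardAut H x₀) := by
  rcases isEmpty_or_nonempty {g : {σ : Equiv.Perm X // σ x₀ = x₀} ×
    {τ : Equiv.Perm X // τ x₀ = x₀} // permuted H g = K} with hE | ⟨⟨g₀, hg₀⟩⟩
  · simp
  have hfix : ∀ σ τ : {σ : Equiv.Perm X // σ x₀ = x₀}, (σ.1 * τ.1⁻¹) x₀ = x₀ := by
    intro σ τ
    rw [Equiv.Perm.mul_apply, Equiv.Perm.inv_eq_iff_eq.2 τ.2.symm, σ.2]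
  refine Nat.card_le_card_of_injective
    (fun g => ⟨(g.1.1.1 * g₀.1.1⁻¹, g.1.2.1 * g₀.2.1⁻¹), ?_, hfix _ _, hfix _ _⟩) ?_
  · have h := g.2.trans hg₀.symm
    ext x y
    have := congrFun₂ h (g₀.1.1⁻¹ x) (g₀.2.1⁻¹ y)
    simpa [permuted] using this
  · intro g g' h
    obtain ⟨h1, h2⟩ := Prod.mk.inj (congrArg Subtype.val h)
    exact Subtype.ext (Prod.ext (Subtype.ext (mul_right_cancel h1))
      (Subtype.ext (mul_right_cancel h2)))

/-- Besides the isomorphism class of `S(H)`, at most `2 |Iso(X, S)| |Aut(X, S)|` choices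
determine a normalized matrix `H` in the given equivalence class. -/
theorem exists_permuted_eq_of_eq [Fintype X] [DecidableEq X] (hS : IsAssociationScheme S)
    {H₀ : Matrix X X ℤ} (hH₀ : H₀.IsHadamard) {x₀ : X} (hnorm : IsNormalizedAt H₀ x₀) :
    ∃ D : {σ : Equiv.Perm X // σ x₀ = x₀} × {τ : Equiv.Perm X // τ x₀ = x₀} →
        Quotient (schemeFamilySetoid S H₀) × ZMod 2 × SchemeIso S S × SchemeAut S,
      ∀ g g', D g = D g' → permuted H₀ g = permuted H₀ g' := by
  have : Nonempty X := ⟨x₀⟩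
  have hHad : ∀ H, HadamardEquivalent H₀ H → H.IsHadamard := fun H h => h.isHadamard hH₀
  have hpm : ∀ g : {σ : Equiv.Perm X // σ x₀ = x₀} × {τ : Equiv.Perm X // τ x₀ = x₀},
      (permuted H₀ g).IsHadamard := fun g => hHad _ (hadamardEquivalent_permuted H₀ g)
  let R : {σ : Equiv.Perm X // σ x₀ = x₀} × {τ : Equiv.Perm X // τ x₀ = x₀} → SchemeFamily S H₀ :=
    fun g => ⟨hadamardScheme S (permuted H₀ g), hadamardScheme_isAssociationScheme hS (hpm g),
      _, hadamardEquivalent_permuted H₀ g, rfl⟩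
  let q := fun g => Quotient.mk (schemeFamilySetoid S H₀) (R g)
  rcases subsingleton_or_nontrivial X with hX | hX
  · refine ⟨fun g => (q g, 0, SchemeIso.refl S, ⟨SchemeIso.refl S, fun _ => rfl⟩),
      fun g g' _ => ?_⟩
    -- For `n = 1` the relation `t̃` is not distinguished from `r¹_H`, but there is only one
    -- normalized matrix.
    ext x y
    rw [Subsingleton.elim x x₀, (hnorm.permuted g y).1, (hnorm.permuted g' y).1]
  · have hbase : ∀ c : Quotient (schemeFamilySetoid S H₀),
        ∃ H, HadamardEquivalent H₀ H ∧ c.out.1 = hadamardScheme S H := fun c => c.out.2.2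
    -- The matrices are compared with one base matrix `B c` per isomorphism class `c`; `B c` need
    -- not be normalized.
    choose B hB hBeq using hbase
    have hdata : ∀ g, ∃ (d : ZMod 2 × SchemeIso S S × SchemeAut S) (u v : X → ZMod 2), ∀ x y,
        signBit (permuted H₀ g) d.1 (d.2.1.onPoints x) (d.2.2.1.onPoints (d.2.1.onPoints y)) =
          signBit (B (q g)) 0 x y + u x + v y := by
      intro g
      obtain ⟨φ⟩ : Nonempty (SchemeIso (q g).out.1 (R g).1) :=
        Quotient.exact (s := schemeFamilySetoid S H₀) (Quotient.out_eq (q g))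
      rw [hBeq] at φ
      exact φ.exists_signBit_eq hS (hHad _ (hB _)).eq_one_or_neg_one (hpm g).eq_one_or_neg_one
        (hadamardScheme_isAssociationScheme hS (hHad _ (hB _)))
        (hadamardScheme_isAssociationScheme hS (hpm g))
    choose d u v hd using hdata
    refine ⟨fun g => (q g, d g), fun g g' h => ?_⟩
    obtain ⟨h1, h2⟩ := Prod.mk.inj h
    have hd' := hd g'
    rw [← h1, ← h2] at hd'
    exact eq_of_signBit_eq (hpm g).eq_one_or_neg_one (hpm g').eq_one_or_neg_one
      (hnorm.permuted g) (hnorm.permuted g') (d g).1 (d g).2.1.onPoints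
      ((d g).2.1.onPoints.trans (d g).2.2.1.onPoints) _ (hd g) hd'

theorem factorial_mul_factorial_le [Fintype X] [DecidableEq X] (hS : IsAssociationScheme S)
    {H₀ : Matrix X X ℤ} (hH₀ : H₀.IsHadamard) {x₀ : X} (hnorm : IsNormalizedAt H₀ x₀) :
    (Fintype.card X - 1).factorial * (Fintype.card X - 1).factorial ≤
      Nat.card (HadamardAut H₀ x₀) *
        (numIsoClasses S H₀ * (2 * (Nat.card (SchemeIso S S) * Nat.card (SchemeAut S)))) := by
  classical
  obtain ⟨D, hD⟩ := exists_permuted_eq_of_eq hS hH₀ hnorm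
  have := Fintype.ofFinite (Quotient (schemeFamilySetoid S H₀) × ZMod 2 ×
    SchemeIso S S × SchemeAut S)
  rw [← card_perm_fixing x₀, ← Nat.card_prod, numIsoClasses, ← Nat.card_zmod 2, ← Nat.card_prod,
    ← Nat.card_prod, ← Nat.card_prod, Nat.card_eq_fintype_card, ← Finset.card_univ]
  refine (Finset.card_le_mul_card_image (f := D) _ (Nat.card (HadamardAut H₀ x₀)) ?_).trans ?_
  · intro c hc
    obtain ⟨g₀, -, rfl⟩ := Finset.mem_image.1 hc
    refine le_trans ?_ (card_permuted_fiber_le H₀ (permuted H₀ g₀) x₀)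
    rw [Nat.card_eq_fintype_card, Fintype.card_subtype]
    refine Finset.card_le_card fun g hg => ?_
    simp only [Finset.mem_filter, Finset.mem_univ, true_and] at hg ⊢
    exact hD _ _ hg
  · rw [Nat.card_eq_fintype_card (α := _ × _)]
    exact Nat.mul_le_mul_left _ (Finset.card_le_univ _)

end

theorem theorem3 {X : Type*} [Fintype X] [DecidableEq X] (S : Set (Set (X × X)))
    (hS : IsAssociationScheme S) (H₀ : Matrix X X ℤ) (hH₀ : H₀.IsHadamard) (x₀ : X)
    (hnorm : IsNormalizedAt H₀ x₀) :
    (∀ H, HadamardEquivalent H₀ H → IsAssociationScheme (hadamardScheme S H)) ∧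
    (((Fintype.card X - 1).factorial : ℚ) * ((Fintype.card X - 1).factorial : ℚ)) /
        (2 * (Nat.card (HadamardAut H₀ x₀) : ℚ) * (Nat.card (SchemeAut S) : ℚ) *
          (Nat.card (SchemeIso S S) : ℚ))
      ≤ (numIsoClasses S H₀ : ℚ) := by
  have : Nonempty X := ⟨x₀⟩
  refine ⟨fun H h => hadamardScheme_isAssociationScheme hS (h.isHadamard hH₀), ?_⟩
  refine div_le_of_le_mul₀ (by positivity) (by positivity) ?_
  calc (((Fintype.card X - 1).factorial : ℚ) * ((Fintype.card X - 1).factorial : ℚ))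
      ≤ Nat.card (HadamardAut H₀ x₀) *
        (numIsoClasses S H₀ * (2 * (Nat.card (SchemeIso S S) * Nat.card (SchemeAut S)))) :=
        mod_cast factorial_mul_factorial_le hS hH₀ hnorm
    _ = _ := by ring
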